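/- Let $K$ be a field of characteristic zero. For a $K$-algebra $B$ let $B[[h]]$ be the $K[[h]]$-algebra of formal power series in the central variable $h$ with coefficients in $B$; for a $K[[h]]$-algebra $A$ let $A/hA$ be the induced $K$-algebra, and for a $K[[h]]$-algebra homomorphism $g$ let $g_{h=0}$ be the induced homomorphism modulo $h$. Let $H, X^-, X^+$ be the Chevalley generators of $\mathfrak{sl}_2$, and let $\mathfrak{a}$ be the Lie algebra over $K$ generated by $H, X^-, X^+$ subject to $[H,X^{\pm}]=\pm 2X^{\pm}$. An $\mathfrak a$-algebra is a $K$-algebra $A_0$ with a structural $K$-algebra homomorphism $U(\mathfrak a)\to A_0$; homomorphisms of $\mathfrak a$-algebras are the $K$-algebra homomorphisms compatible with the structural homomorphisms. The projection $\mathfrak a\to\mathfrak{sl}_2$ makes $U(\mathfrak{sl}_2)$ an $\mathfrak a$-algebra. A formal deformation of the $\mathfrak a$-algebra $U(\mathfrak{sl}_2)$ is a $K[[h]]$-algebra $A$ with a structural $K[[h]]$-algebra homomorphism $U(\mathfrak a)[[h]]\to A$, such that $A$ is topologically free over $K[[h]]$ (Hausdorff and complete for the $h$-adic topology, and torsion-free)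 and such that $A/hA$, with the induced $\mathfrak a$-algebra structure, is isomorphic to $U(\mathfrak{sl}_2)$ as an $\mathfrak a$-algebra. The images of $H,X^-,X^+$ in $A$ are denoted by the same letters. An $\mathfrak h$-trivialization of $A$ is a $K[[h]]$-algebra isomorphism $g: U(\mathfrak{sl}_2)[[h]]\to A$ such that $g(H)=H$ and such that $g_{h=0}$ is an isomorphism of $\mathfrak a$-algebras. A $\mathfrak b$-trivialization of $A$ is an $\mathfrak h$-trivialization $g$ such that moreover $g(X^-)=X^-$. The deformation $A$ is called $\mathfrak h$-trivial (respectively $\mathfrak b$-trivial) if it admits an $\mathfrak h$-trivialization (respectively a $\mathfrak b$-trivialization). **Corollary.** Every $\mathfrak h$-trivial formal deformation $A$ of the $\mathfrak a$-algebra $U(\mathfrak{sl}_2)$ is also $\mathfrak b$-trivial, and it admits a unique $\mathfrak b$-trivialization. -/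

import Mathlib

open PowerSeries

noncomputable section

/-! ## Constant formal deformations: the `K⟦X⟧`-algebra `B⟦X⟧` of a `K`-algebra `B`

The deformation parameter `h` is the variable `X` of `PowerSeries`. The algebra `B` need not be
commutative; `X` is central in `B⟦X⟧`. -/

section Constant

variable {K : Type*} [Field K] {B : Type*} [Ring B] [Algebra K B]

/-- The `K⟦X⟧`-algebra structure on `B⟦X⟧` induced by the `K`-algebra structure on `B`. -/
instance (priority := 50) constantDeformationAlgebra : Algebra K⟦X⟧ B⟦X⟧ where
  smul r f := PowerSeries.map (algebraMap K B) r * f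
  algebraMap := PowerSeries.map (algebraMap K B)
  commutes' r f := by
    ext n
    rw [PowerSeries.coeff_mul, PowerSeries.coeff_mul]
    refine Finset.sum_equiv (Equiv.prodComm ℕ ℕ) (by simp [add_comm]) fun p _ => ?_
    rw [PowerSeries.coeff_map, Algebra.commutes]
    simp
  smul_def' _ _ := rfl

theorem constantDeformation_algebraMap_apply (r : K⟦X⟧) :
    algebraMap K⟦X⟧ B⟦X⟧ r = PowerSeries.map (algebraMap K B) r := rfl

variable {B' : Type*} [Ring B'] [Algebra K B']

/-- A `K`-algebra homomorphism `f : B → B'` induces the `K⟦X⟧`-algebra homomorphism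
`B⟦X⟧ → B'⟦X⟧` which applies `f` to every coefficient; this is the structure of
`B⟦X⟧`-algebra on `B'⟦X⟧` for a `B`-algebra `B'`. -/
def constantDeformationMap (f : B →ₐ[K] B') : B⟦X⟧ →ₐ[K⟦X⟧] B'⟦X⟧ where
  __ := PowerSeries.map (f : B →+* B')
  commutes' r := by
    ext n
    simp [constantDeformation_algebraMap_apply]

end Constant

/-! ## Reduction modulo `h` and topologically free modules -/

section Reduction

variable (K : Type*) [Field K] (A : Type*) [Ring A] [Algebra K⟦X⟧ A]

/-- The two-sided ideal `h A` of a `K⟦X⟧`-algebra `A`. -/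
def hIdeal : Ideal A := Ideal.span {algebraMap K⟦X⟧ A (X : K⟦X⟧)}

instance hIdeal_isTwoSided : (hIdeal K A).IsTwoSided where
  mul_mem_of_left {a} b ha := by
    obtain ⟨c, rfl⟩ := Ideal.mem_span_singleton'.mp ha
    refine Ideal.mem_span_singleton'.mpr ⟨c * b, ?_⟩
    rw [mul_assoc, mul_assoc, Algebra.commutes]

/-- The reduction `A / h A`. -/
def HZero : Type _ := A ⧸ hIdeal K A

instance : Ring (HZero K A) := inferInstanceAs (Ring (A ⧸ hIdeal K A))

instance : Algebra K⟦X⟧ (HZero K A) := inferInstanceAs (Algebra K⟦X⟧ (A ⧸ hIdeal K A))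

/-- `A / h A` is a `K`-algebra, where `K` is regarded as a subring of `K⟦X⟧`. -/
instance : Algebra K (HZero K A) := Algebra.compHom (HZero K A) (PowerSeries.C (R := K))

/-- The projection `A → A / h A`. -/
def HZero.mk : A →+* HZero K A := Ideal.Quotient.mk (hIdeal K A)

theorem HZero.algebraMap_apply (c : K) :
    algebraMap K (HZero K A) c = HZero.mk K A (algebraMap K⟦X⟧ A (PowerSeries.C c)) := rfl

/-- A `K⟦X⟧`-module is topologically free if it is Hausdorff and complete for the `h`-adic
topology, and torsion-free; equivalently, if it is isomorphic to `V₀⟦X⟧` for some `K`-vector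
space `V₀`. -/
def IsTopologicallyFree (V : Type*) [AddCommGroup V] [Module K⟦X⟧ V] : Prop :=
  IsAdicComplete (Ideal.span {(X : K⟦X⟧)}) V ∧ Module.IsTorsionFree K⟦X⟧ V

variable {K A} {A' : Type*} [Ring A'] [Algebra K⟦X⟧ A']

/-- The `K`-algebra homomorphism `A / h A → A' / h A'` induced by a `K⟦X⟧`-algebra
homomorphism `A → A'`. -/
def HZero.map (g : A →ₐ[K⟦X⟧] A') : HZero K A →ₐ[K] HZero K A' where
  __ := Ideal.Quotient.lift (hIdeal K A) ((HZero.mk K A').comp (g : A →+* A')) (by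
    intro a ha
    obtain ⟨c, rfl⟩ := Ideal.mem_span_singleton'.mp ha
    refine Ideal.Quotient.eq_zero_iff_mem.mpr (Ideal.mem_span_singleton'.mpr ⟨g c, ?_⟩)
    simp)
  commutes' c := by
    change HZero.mk K A' (g (algebraMap K⟦X⟧ A (PowerSeries.C c))) = _
    rw [AlgHom.commutes, HZero.algebraMap_apply]

theorem HZero.map_mk (g : A →ₐ[K⟦X⟧] A') (a : A) :
    HZero.map g (HZero.mk K A a) = HZero.mk K A' (g a) := rfl

variable {B₀ : Type*} [Ring B₀] [Algebra K B₀]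

/-- A `B₀⟦X⟧`-algebra `A`, with structural homomorphism `φ`, induces a structure of
`B₀`-algebra on `A / h A`; this is its structural homomorphism. -/
def HZero.structural (φ : B₀⟦X⟧ →ₐ[K⟦X⟧] A) : B₀ →ₐ[K] HZero K A where
  __ := (HZero.mk K A).comp ((φ : B₀⟦X⟧ →+* A).comp (PowerSeries.C (R := B₀)))
  commutes' c := by
    change HZero.mk K A (φ (PowerSeries.C (algebraMap K B₀ c))) = _
    rw [HZero.algebraMap_apply, ← AlgHom.commutes φ, constantDeformation_algebraMap_apply,
      PowerSeries.map_C]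

/-- Let `A₀` be a `B₀`-algebra with (surjective) structural homomorphism `π`. A `B₀⟦X⟧`-algebra
`A` with structural homomorphism `φ` is a formal deformation of the `B₀`-algebra `A₀` if it is
topologically free and if the `B₀`-algebras `A / h A` and `A₀` are isomorphic. -/
def IsFormalDeformation {A₀ : Type*} [Ring A₀] [Algebra K A₀] (π : B₀ →ₐ[K] A₀)
    (φ : B₀⟦X⟧ →ₐ[K⟦X⟧] A) : Prop :=
  IsTopologicallyFree K A ∧
    ∃ e : A₀ ≃ₐ[K] HZero K A, ∀ b : B₀, e (π b) = HZero.structural φ b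

end Reduction

/-! ## The Lie algebras `sl₂` and `𝔞`, and their enveloping algebras -/

section LieAlgebras

attribute [local instance 100] LieRing.ofAssociativeRing

variable (K : Type*) [Field K]

/-- The Lie algebra `sl₂` of traceless `2 × 2` matrices. -/
abbrev Sl2 : Type _ := LieAlgebra.SpecialLinear.sl (Fin 2) K

/-- The names of the three Chevalley generators `H`, `X⁻`, `X⁺`. -/
inductive ChevalleyGen
  | H
  | Xm
  | Xp

/-- The Chevalley generators `H`, `X⁻`, `X⁺` of `sl₂`. -/
def Sl2.gen : ChevalleyGen → Sl2 K
  | .H => ⟨!![1, 0; 0, -1], by simp [LieAlgebra.SpecialLinear.sl]⟩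
  | .Xm => ⟨!![0, 0; 1, 0], by simp [LieAlgebra.SpecialLinear.sl]⟩
  | .Xp => ⟨!![0, 1; 0, 0], by simp [LieAlgebra.SpecialLinear.sl]⟩

/-- The ideal of the free Lie algebra on `H`, `X⁻`, `X⁺` generated by the non-deformed relations
`[H, X⁺] = 2 X⁺` and `[H, X⁻] = -2 X⁻`. -/
def nonDeformedRelations : LieIdeal K (FreeLieAlgebra K ChevalleyGen) :=
  LieSubmodule.lieSpan K (FreeLieAlgebra K ChevalleyGen)
    {⁅FreeLieAlgebra.of K ChevalleyGen.H, FreeLieAlgebra.of K ChevalleyGen.Xp⁆ - (2 : K) • FreeLieAlgebra.of K ChevalleyGen.Xp,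
     ⁅FreeLieAlgebra.of K ChevalleyGen.H, FreeLieAlgebra.of K ChevalleyGen.Xm⁆ + (2 : K) • FreeLieAlgebra.of K ChevalleyGen.Xm}

/-- The Lie algebra `𝔞` generated by `H`, `X⁻`, `X⁺`, subject to the non-deformed relations. -/
abbrev ALie : Type _ := FreeLieAlgebra K ChevalleyGen ⧸ nonDeformedRelations K

/-- The generators `H`, `X⁻`, `X⁺` of `𝔞`. -/
def ALie.gen (x : ChevalleyGen) : ALie K :=
  LieSubmodule.Quotient.mk (N := nonDeformedRelations K) (FreeLieAlgebra.of K x)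

theorem nonDeformedRelations_le_ker :
    nonDeformedRelations K ≤ (FreeLieAlgebra.lift K (Sl2.gen K)).ker := by
  refine (LieSubmodule.lieSpan_le (R := K) (L := FreeLieAlgebra K ChevalleyGen)).mpr ?_
  rintro x (rfl | rfl)
  · change FreeLieAlgebra.lift K (Sl2.gen K) _ = 0
    rw [map_sub, LieHom.map_lie, map_smul]
    simp only [FreeLieAlgebra.lift_of_apply]
    ext i j
    fin_cases i <;> fin_cases j <;>
      (simp [Sl2.gen, Ring.lie_def]; try norm_num)
  · change FreeLieAlgebra.lift K (Sl2.gen K) _ = 0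
    rw [map_add, LieHom.map_lie, map_smul]
    simp only [FreeLieAlgebra.lift_of_apply]
    ext i j
    fin_cases i <;> fin_cases j <;>
      (simp [Sl2.gen, Ring.lie_def]; try norm_num)

/-- The projection `𝔞 → sl₂`, sending generators to generators. -/
def ALie.toSl2 : ALie K →ₗ⁅K⁆ Sl2 K where
  __ := Submodule.liftQ (nonDeformedRelations K).toSubmodule
    (FreeLieAlgebra.lift K (Sl2.gen K) : FreeLieAlgebra K ChevalleyGen →ₗ[K] Sl2 K)
    (fun _ hx => nonDeformedRelations_le_ker K hx)
  map_lie' := by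
    rintro ⟨x⟩ ⟨y⟩
    exact LieHom.map_lie (FreeLieAlgebra.lift K (Sl2.gen K)) x y

theorem ALie.toSl2_gen (x : ChevalleyGen) : ALie.toSl2 K (ALie.gen K x) = Sl2.gen K x :=
  FreeLieAlgebra.lift_of_apply (R := K) (Sl2.gen K) x

/-- The enveloping algebra `U(sl₂)`. -/
abbrev USl2 : Type _ := UniversalEnvelopingAlgebra K (Sl2 K)

/-- The enveloping algebra `U(𝔞)`. -/
abbrev UALie : Type _ := UniversalEnvelopingAlgebra K (ALie K)

/-- The structure of `𝔞`-algebra on `U(sl₂)`: the homomorphism `U(𝔞) → U(sl₂)` induced by the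
projection `𝔞 → sl₂`. -/
def USl2.structural : UALie K →ₐ[K] USl2 K :=
  UniversalEnvelopingAlgebra.lift K
    ((UniversalEnvelopingAlgebra.ι K : Sl2 K →ₗ⁅K⁆ USl2 K).comp (ALie.toSl2 K))

/-- The elements `H`, `X⁻`, `X⁺` of `U(sl₂)⟦X⟧`. -/
def USl2.gen (x : ChevalleyGen) : (USl2 K)⟦X⟧ :=
  PowerSeries.C (UniversalEnvelopingAlgebra.ι K (Sl2.gen K x))

/-- The elements `H`, `X⁻`, `X⁺` of `U(𝔞)⟦X⟧`. -/
def UALie.gen (x : ChevalleyGen) : (UALie K)⟦X⟧ :=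
  PowerSeries.C (UniversalEnvelopingAlgebra.ι K (ALie.gen K x))

end LieAlgebras

/-! ## Trivializations -/

section Trivializations

variable {K : Type*} [Field K] {A : Type*} [Ring A] [Algebra K⟦X⟧ A]

/-- The reduction of `g` modulo `h` is an isomorphism of `𝔞`-algebras from `U(sl₂)⟦X⟧ / h` to
`A / h A`, where `A` is a `U(𝔞)⟦X⟧`-algebra with structural homomorphism `φ`. -/
def ReducesToALieIso (φ : (UALie K)⟦X⟧ →ₐ[K⟦X⟧] A) (g : (USl2 K)⟦X⟧ ≃ₐ[K⟦X⟧] A) : Prop :=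
  Function.Bijective (HZero.map (g : (USl2 K)⟦X⟧ →ₐ[K⟦X⟧] A)) ∧
    ∀ x : UALie K,
      HZero.map (g : (USl2 K)⟦X⟧ →ₐ[K⟦X⟧] A)
        (HZero.structural (constantDeformationMap (USl2.structural K)) x) =
        HZero.structural φ x

/-- `g` is an `𝔥`-trivialization: an isomorphism `U(sl₂)⟦X⟧ ≃ A` with `g(H) = H`, whose reduction
modulo `h` is an isomorphism of `𝔞`-algebras. -/
def IsHTrivialization (φ : (UALie K)⟦X⟧ →ₐ[K⟦X⟧] A) (g : (USl2 K)⟦X⟧ ≃ₐ[K⟦X⟧] A) : Prop :=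
  g (USl2.gen K .H) = φ (UALie.gen K .H) ∧ ReducesToALieIso φ g

/-- `g` is a `𝔟`-trivialization: an isomorphism `U(sl₂)⟦X⟧ ≃ A` with `g(H) = H` and
`g(X⁻) = X⁻`, whose reduction modulo `h` is an isomorphism of `𝔞`-algebras. -/
def IsBTrivialization (φ : (UALie K)⟦X⟧ →ₐ[K⟦X⟧] A) (g : (USl2 K)⟦X⟧ ≃ₐ[K⟦X⟧] A) : Prop :=
  g (USl2.gen K .H) = φ (UALie.gen K .H) ∧ g (USl2.gen K .Xm) = φ (UALie.gen K .Xm) ∧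
    ReducesToALieIso φ g

/-- The `U(𝔞)⟦X⟧`-algebra `A` is `𝔥`-trivial. -/
def IsHTrivial (φ : (UALie K)⟦X⟧ →ₐ[K⟦X⟧] A) : Prop :=
  ∃ g : (USl2 K)⟦X⟧ ≃ₐ[K⟦X⟧] A, IsHTrivialization φ g

/-- The `U(𝔞)⟦X⟧`-algebra `A` is `𝔟`-trivial. -/
def IsBTrivial (φ : (UALie K)⟦X⟧ →ₐ[K⟦X⟧] A) : Prop :=
  ∃ g : (USl2 K)⟦X⟧ ≃ₐ[K⟦X⟧] A, IsBTrivialization φ g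

end Trivializations

end

open PowerSeries

noncomputable section

/-! ## Associative algebras generated by an `sl₂`-triple -/

/-! Write `U = U(sl₂)` and call `y` of weight `m` when `[H, y] = m y`. Let `g` be an
`𝔥`-trivialization and `Y = g⁻¹(X⁻)`. Since `g(H) = H`, `Y` has weight `-2`, and it reduces to `X⁻`
modulo `h`. It suffices to find an automorphism `ψ` of `U⟦X⟧`, trivial modulo `h`, that fixes `H`
and sends `X⁻` to `Y`; then `g ∘ ψ` is a `𝔟`-trivialization.

Existence of `ψ`: weight `-2` elements of `U` have the form `X⁻ u` with `u` in the commutative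
algebra generated by `H` and `X⁻X⁺` (`Sl2Relations.exists_eq_f_mul`). Coefficientwise, `Y = X⁻ w`
with `w` commuting with `H` and `X⁻X⁺`, and `w ≡ 1`, so `w` is invertible. Then `(H, w⁻¹X⁺, X⁻w)` is
again an `sl₂`-triple (`Sl2Relations.twist`), and the endomorphism it defines is the identity modulo
`h`, hence bijective.

Uniqueness: if `θ` fixes `H` and `X⁻`, then `θ(X⁺) - X⁺` has weight `2` and commutes with `X⁻`. A
nonzero such element would be a lowest weight vector of positive weight for the adjoint action, on
which `ad X⁺` is locally nilpotent; this is impossible (`Sl2Relations.eq_zero_of_commute_f`).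

Only generation of `U` by the triple is needed, not the PBW basis. -/

/-- The defining relations of `U(sl₂)` for elements `h`, `e`, `f` of an associative ring. -/
structure Sl2Relations {B : Type*} [Ring B] (h e f : B) : Prop where
  h_mul_e : h * e = e * h + 2 * e
  h_mul_f : h * f = f * h - 2 * f
  e_mul_f : e * f = f * e + h

namespace Sl2Relations

section Ring

variable {B : Type*} [Ring B] {h e f : B}

theorem h_mul_e_pow (r : Sl2Relations h e f) (n : ℕ) :
    h * e ^ n = e ^ n * h + (2 * n : ℕ) * e ^ n := by
  induction n with
  | zero => simp
  | succ n ih =>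
    have c : ((2 * n : ℕ) : B) * e ^ n * e = e ^ n * e * (2 * n : ℕ) := by
      rw [mul_assoc, Nat.cast_commute]
    rw [pow_succ, ← mul_assoc, ih, add_mul, mul_assoc, r.h_mul_e, c, Nat.cast_commute]
    push_cast
    rw [← Nat.cast_ofNat (R := B), Nat.cast_commute 2 e]
    noncomm_ring

theorem h_mul_f_pow (r : Sl2Relations h e f) (n : ℕ) :
    h * f ^ n = f ^ n * h - (2 * n : ℕ) * f ^ n := by
  induction n with
  | zero => simp
  | succ n ih =>
    have c : ((2 * n : ℕ) : B) * f ^ n * f = f ^ n * f * (2 * n : ℕ) := by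
      rw [mul_assoc, Nat.cast_commute]
    rw [pow_succ, ← mul_assoc, ih, sub_mul, mul_assoc, r.h_mul_f, c, Nat.cast_commute]
    push_cast
    rw [← Nat.cast_ofNat (R := B), Nat.cast_commute 2 f]
    noncomm_ring

end Ring

section Algebra

variable {K : Type*} [Field K] {B : Type*} [Ring B] [Algebra K B] {h e f : B}

/-- `f * e` has weight zero, so the two generators commute. Commuting with both of them is exactly
what twisting a triple requires. -/
theorem weightZero_commute (r : Sl2Relations h e f) :
    ∀ u ∈ Algebra.adjoin K {h, f * e}, h * u = u * h ∧ (f * e) * u = u * (f * e) := by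
  have hc : h * (f * e) = f * e * h := by
    rw [← mul_assoc, r.h_mul_f, sub_mul, mul_assoc, r.h_mul_e]
    noncomm_ring
  intro u hu
  induction hu using Algebra.adjoin_induction with
  | mem x hx =>
    rcases hx with rfl | rfl
    · exact ⟨rfl, hc.symm⟩
    · exact ⟨hc, rfl⟩
  | algebraMap c => exact ⟨(Algebra.commutes c _).symm, (Algebra.commutes c _).symm⟩
  | add x y _ _ hx hy =>
    simp only [mul_add, add_mul, hx.1, hx.2, hy.1, hy.2, and_self]
  | mul x y _ _ hx hy =>
    constructor
    · rw [← mul_assoc, hx.1, mul_assoc, hy.1, mul_assoc]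
    · rw [← mul_assoc, hx.2, mul_assoc, hy.2, mul_assoc]

/-- If the generators of `adjoin K s` can be moved across `a`, then so can all its elements. -/
theorem _root_.Algebra.exists_mul_eq_mul_of_mem_adjoin {s : Set B} {a : B}
    (hs : ∀ x ∈ s, ∃ u ∈ Algebra.adjoin K s, x * a = a * u) :
    ∀ x ∈ Algebra.adjoin K s, ∃ u ∈ Algebra.adjoin K s, x * a = a * u := by
  intro x hx
  induction hx using Algebra.adjoin_induction with
  | mem x hx => exact hs x hx
  | algebraMap c => exact ⟨_, Subalgebra.algebraMap_mem _ c, Algebra.commutes c a⟩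
  | add x y _ _ hx hy =>
    obtain ⟨u, hu, hu'⟩ := hx
    obtain ⟨v, hv, hv'⟩ := hy
    exact ⟨u + v, add_mem hu hv, by rw [add_mul, hu', hv', mul_add]⟩
  | mul x y _ _ hx hy =>
    obtain ⟨u, hu, hu'⟩ := hx
    obtain ⟨v, hv, hv'⟩ := hy
    exact ⟨u * v, mul_mem hu hv, by rw [mul_assoc, hv', ← mul_assoc, hu', mul_assoc]⟩

theorem _root_.Algebra.exists_mul_pow_eq_pow_mul_of_mem_adjoin {s : Set B} {a : B}
    (hs : ∀ x ∈ s, ∃ u ∈ Algebra.adjoin K s, x * a = a * u) (n : ℕ) :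
    ∀ x ∈ Algebra.adjoin K s, ∃ u ∈ Algebra.adjoin K s, x * a ^ n = a ^ n * u := by
  induction n with
  | zero => intro x hx; exact ⟨x, hx, by simp⟩
  | succ n ih =>
    intro x hx
    obtain ⟨u, hu, hu'⟩ := ih x hx
    obtain ⟨v, hv, hv'⟩ := Algebra.exists_mul_eq_mul_of_mem_adjoin hs u hu
    exact ⟨v, hv, by rw [pow_succ, ← mul_assoc, hu', mul_assoc, hv', mul_assoc]⟩

theorem weightZero_mul_e (r : Sl2Relations h e f) :
    ∀ x ∈ ({h, f * e} : Set B), ∃ u ∈ Algebra.adjoin K {h, f * e}, x * e = e * u := by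
  have hh : h ∈ Algebra.adjoin K {h, f * e} := Algebra.subset_adjoin (by simp)
  have hc : f * e ∈ Algebra.adjoin K {h, f * e} := Algebra.subset_adjoin (by simp)
  have h2 : (2 : B) ∈ Algebra.adjoin K {h, f * e} := ofNat_mem _ 2
  have he : (2 : B) * e = e * 2 := (Nat.cast_commute 2 e)
  rintro x (rfl | rfl)
  · exact ⟨x + 2, add_mem hh h2, by rw [r.h_mul_e, mul_add, he]⟩
  -- From `e * (f * e) = (f * e + h) * e` and `h * e = e * (h + 2)`.
  · refine ⟨f * e - h - 2, sub_mem (sub_mem hc hh) h2, ?_⟩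
    rw [mul_sub, mul_sub, ← he, ← mul_assoc e f e, r.e_mul_f, add_mul, r.h_mul_e]
    noncomm_ring

theorem weightZero_mul_f (r : Sl2Relations h e f) :
    ∀ x ∈ ({h, f * e} : Set B), ∃ u ∈ Algebra.adjoin K {h, f * e}, x * f = f * u := by
  have hh : h ∈ Algebra.adjoin K {h, f * e} := Algebra.subset_adjoin (by simp)
  have hc : f * e ∈ Algebra.adjoin K {h, f * e} := Algebra.subset_adjoin (by simp)
  have h2 : (2 : B) ∈ Algebra.adjoin K {h, f * e} := ofNat_mem _ 2
  have he : (2 : B) * f = f * 2 := (Nat.cast_commute 2 f)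
  rintro x (rfl | rfl)
  · exact ⟨x - 2, sub_mem hh h2, by rw [r.h_mul_f, mul_sub, he]⟩
  · exact ⟨f * e + h, add_mem hc hh, by rw [mul_assoc, r.e_mul_f]⟩

/-- An algebra generated by an `sl₂`-triple is spanned by the products of powers of `e` or `f`
with elements of weight zero in the subalgebra generated by `h` and `f * e`. -/
theorem span_eq_top (r : Sl2Relations h e f) (hg : Algebra.adjoin K {h, e, f} = ⊤) :
    Submodule.span K {y : B | ∃ n : ℕ, ∃ u ∈ Algebra.adjoin K {h, f * e},
      y = e ^ n * u ∨ y = f ^ n * u} = ⊤ := by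
  set U₀ := Algebra.adjoin K {h, f * e} with hU₀
  set N := Submodule.span K {y : B | ∃ n : ℕ, ∃ u ∈ U₀, y = e ^ n * u ∨ y = f ^ n * u} with hN
  have hh : h ∈ U₀ := Algebra.subset_adjoin (by simp)
  have hc : f * e ∈ U₀ := Algebra.subset_adjoin (by simp)
  have hE : ∀ n : ℕ, ∀ u ∈ U₀, e ^ n * u ∈ N := fun n u hu =>
    Submodule.subset_span ⟨n, u, hu, Or.inl rfl⟩
  have hF : ∀ n : ℕ, ∀ u ∈ U₀, f ^ n * u ∈ N := fun n u hu =>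
    Submodule.subset_span ⟨n, u, hu, Or.inr rfl⟩
  -- `N` contains `1`, so stability under left multiplication by the generators suffices. Mixed
  -- products drop a power: `e * f ^ (n + 1) = (f * e + h) * f ^ n` and `f * e ^ (n + 1) = (f * e) *
  -- e ^ n`, after which the weight-zero factor moves to the right.
  have key : ∀ a ∈ ({h, e, f} : Set B), ∀ y ∈ N, a * y ∈ N := by
    intro a ha y hy
    induction hy using Submodule.span_induction with
    | zero => simp
    | add x y _ _ hx hy => rw [mul_add]; exact add_mem hx hy
    | smul c x _ hx => rw [mul_smul_comm]; exact N.smul_mem c hx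
    | mem y hy =>
      obtain ⟨n, u, hu, hy⟩ := hy
      have eU : ∀ x ∈ U₀, x * (e ^ n * u) ∈ N := by
        intro x hx
        obtain ⟨v, hv, hv'⟩ :=
          Algebra.exists_mul_pow_eq_pow_mul_of_mem_adjoin r.weightZero_mul_e n x hx
        rw [← mul_assoc, hv', mul_assoc]
        exact hE n _ (mul_mem hv hu)
      have fU : ∀ x ∈ U₀, x * (f ^ n * u) ∈ N := by
        intro x hx
        obtain ⟨v, hv, hv'⟩ :=
          Algebra.exists_mul_pow_eq_pow_mul_of_mem_adjoin r.weightZero_mul_f n x hx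
        rw [← mul_assoc, hv', mul_assoc]
        exact hF n _ (mul_mem hv hu)
      rcases ha with rfl | rfl | rfl
      · rcases hy with rfl | rfl
        · exact eU _ hh
        · exact fU _ hh
      · rcases hy with rfl | rfl
        · rw [← mul_assoc, ← pow_succ']
          exact hE _ _ hu
        · rcases n with _ | n
          · simpa using hE 1 u hu
          · obtain ⟨v, hv, hv'⟩ := Algebra.exists_mul_pow_eq_pow_mul_of_mem_adjoin
              r.weightZero_mul_f n _ (add_mem hc hh)
            rw [pow_succ', ← mul_assoc, ← mul_assoc, r.e_mul_f, hv', mul_assoc]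
            exact hF n _ (mul_mem hv hu)
      · rcases hy with rfl | rfl
        · rcases n with _ | n
          · simpa using hF 1 u hu
          · obtain ⟨v, hv, hv'⟩ := Algebra.exists_mul_pow_eq_pow_mul_of_mem_adjoin
              r.weightZero_mul_e n _ hc
            rw [pow_succ', ← mul_assoc, ← mul_assoc, hv', mul_assoc]
            exact hE n _ (mul_mem hv hu)
        · rw [← mul_assoc, ← pow_succ']
          exact hF _ _ hu
  have all : ∀ a ∈ Algebra.adjoin K {h, e, f}, ∀ y ∈ N, a * y ∈ N := by
    intro a ha
    induction ha using Algebra.adjoin_induction with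
    | mem a ha => exact key a ha
    | algebraMap c =>
      intro y hy
      rw [← Algebra.smul_def]
      exact N.smul_mem c hy
    | add a b _ _ ha hb =>
      intro y hy
      rw [add_mul]
      exact add_mem (ha y hy) (hb y hy)
    | mul a b _ _ ha hb =>
      intro y hy
      rw [mul_assoc]
      exact ha _ (hb y hy)
  refine eq_top_iff.mpr fun a _ => ?_
  have h1 : (1 : B) ∈ N := by simpa using hE 0 1 (one_mem _)
  simpa using all a (hg ▸ Algebra.mem_top) 1 h1

/-- In an algebra generated by an `sl₂`-triple, the elements of weight `-2` are the products of
`f` with elements of the commutative algebra generated by `h` and `f * e`. -/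
theorem exists_eq_f_mul [CharZero K] (r : Sl2Relations h e f)
    (hg : Algebra.adjoin K {h, e, f} = ⊤) {y : B} (hy : h * y = y * h - 2 * y) :
    ∃ u ∈ Algebra.adjoin K {h, f * e}, y = f * u := by
  -- `D = ad h` acts on `e ^ n * u` by `2n` and on `f ^ n * u` by `-2n`. In characteristic zero only
  -- the `f * u` have eigenvalue `-2`, so the rest of the spanning set lies in `E`, and independence
  -- of eigenspaces removes the `E`-component of `y`.
  let D : Module.End K B := LinearMap.mulLeft K h - LinearMap.mulRight K h
  have hD : ∀ y, D y = h * y - y * h := fun y => rfl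
  let M : Submodule K B :=
    (Subalgebra.toSubmodule (Algebra.adjoin K {h, f * e})).map (LinearMap.mulLeft K f)
  let E : Submodule K B := ⨆ μ : K, ⨆ _ : μ ≠ -2, D.eigenspace μ
  have hE : ∀ (μ : K), μ ≠ -2 → ∀ y, D y = μ • y → y ∈ E := fun μ hμ y hy =>
    Submodule.mem_iSup_of_mem μ (Submodule.mem_iSup_of_mem hμ
      (Module.End.mem_eigenspace_iff.mpr hy))
  have hm : ∀ u ∈ Algebra.adjoin K {h, f * e}, D (f * u) = (-2 : K) • (f * u) := by
    intro u hu
    rw [hD, ← mul_assoc, r.h_mul_f, mul_assoc f u h, ← (r.weightZero_commute u hu).1,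
      Algebra.smul_def]
    simp only [map_neg, map_ofNat]
    noncomm_ring
  have top : M ⊔ E = ⊤ := by
    rw [eq_top_iff, ← r.span_eq_top hg, Submodule.span_le]
    rintro z ⟨n, u, hu, rfl | rfl⟩
    · refine Submodule.mem_sup_right (hE (2 * n) ?_ _ ?_)
      · intro hn
        have : ((2 * n + 2 : ℕ) : K) = 0 := by push_cast; rw [hn]; ring
        norm_cast at this
      · rw [hD, ← mul_assoc, r.h_mul_e_pow, mul_assoc _ u h, ← (r.weightZero_commute u hu).1,
          Algebra.smul_def]
        push_cast
        simp only [map_ofNat]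
        noncomm_ring
    · rcases eq_or_ne n 1 with rfl | hn1
      · exact Submodule.mem_sup_left ⟨u, hu, by simp⟩
      · refine Submodule.mem_sup_right (hE (-(2 * n)) ?_ _ ?_)
        · intro hn
          have : ((2 * n : ℕ) : K) = (2 : ℕ) := by push_cast; exact neg_injective hn
          have := Nat.cast_injective this
          omega
        · rw [hD, ← mul_assoc, r.h_mul_f_pow, mul_assoc _ u h, ← (r.weightZero_commute u hu).1,
            Algebra.smul_def]
          push_cast
          simp only [map_ofNat]
          noncomm_ring
  obtain ⟨m, hmM, z, hz, rfl⟩ := Submodule.mem_sup.mp (top ▸ Submodule.mem_top : y ∈ M ⊔ E)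
  obtain ⟨u, hu, rfl⟩ := hmM
  refine ⟨u, hu, ?_⟩
  have hyD : D (f * u + z) = (-2 : K) • (f * u + z) := by
    rw [hD]
    simp only [LinearMap.mulLeft_apply] at hy
    rw [hy, Algebra.smul_def]
    simp only [map_neg, map_ofNat]
    noncomm_ring
  have hzD : z ∈ D.eigenspace (-2) := by
    rw [Module.End.mem_eigenspace_iff]
    rw [map_add, hm u hu, smul_add] at hyD
    exact add_left_cancel hyD
  have : z = 0 := Submodule.disjoint_def.mp (D.eigenspaces_iSupIndep (-2)) z hzD hz
  simp [this]

/-- The inner derivation `x ↦ e * x - x * e` is locally nilpotent if it is so on generators. -/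
theorem ad_pow_mul_eq_zero (e : B) (N : ℕ) : ∀ (m n : ℕ), m + n = N → ∀ a b : B,
    ((LinearMap.mulLeft K e - LinearMap.mulRight K e) ^ m) a = 0 →
    ((LinearMap.mulLeft K e - LinearMap.mulRight K e) ^ n) b = 0 →
    ((LinearMap.mulLeft K e - LinearMap.mulRight K e) ^ N) (a * b) = 0 := by
  induction N with
  | zero =>
    intro m n hmn a b ha hb
    obtain rfl : m = 0 := by omega
    simp_all
  | succ N ih =>
    intro m n hmn a b ha hb
    rcases m with _ | m
    · simp_all
    rcases n with _ | n
    · simp_all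
    -- The Leibniz rule lowers one of the two exponents in each summand, which replaces the binomial
    -- expansion.
    have hd : (LinearMap.mulLeft K e - LinearMap.mulRight K e) (a * b) =
        (LinearMap.mulLeft K e - LinearMap.mulRight K e) a * b +
          a * (LinearMap.mulLeft K e - LinearMap.mulRight K e) b := by
      simp only [LinearMap.sub_apply, LinearMap.mulLeft_apply, LinearMap.mulRight_apply]
      noncomm_ring
    rw [pow_succ, Module.End.mul_apply, hd, map_add,
      ih m (n + 1) (by omega) _ _ (by rw [← Module.End.mul_apply, ← pow_succ]; exact ha) hb,
      ih (m + 1) n (by omega) _ _ ha (by rw [← Module.End.mul_apply, ← pow_succ]; exact hb),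
      add_zero]

theorem exists_ad_e_pow_eq_zero (r : Sl2Relations h e f)
    (hg : Algebra.adjoin K {h, e, f} = ⊤) (y : B) :
    ∃ n : ℕ, ((LinearMap.mulLeft K e - LinearMap.mulRight K e) ^ n) y = 0 := by
  have hy : y ∈ Algebra.adjoin K {h, e, f} := hg ▸ Algebra.mem_top
  induction hy using Algebra.adjoin_induction with
  | mem x hx =>
    -- `ad e` sends `f` to `h`, `h` to `-2e` and `e` to `0`, so the third power kills every
    -- generator.
    refine ⟨3, ?_⟩
    rcases hx with rfl | rfl | rfl
    · simp only [pow_succ, pow_zero, one_mul, Module.End.mul_apply, LinearMap.sub_apply,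
        LinearMap.mulLeft_apply, LinearMap.mulRight_apply, r.h_mul_e]
      noncomm_ring
    · simp [pow_succ]
    · simp only [pow_succ, pow_zero, one_mul, Module.End.mul_apply, LinearMap.sub_apply,
        LinearMap.mulLeft_apply, LinearMap.mulRight_apply, r.e_mul_f, add_sub_cancel_left,
        r.h_mul_e]
      noncomm_ring
  | algebraMap c => exact ⟨1, by simp [Algebra.commutes c e]⟩
  | add x y _ _ hx hy =>
    obtain ⟨m, hm⟩ := hx
    obtain ⟨n, hn⟩ := hy
    refine ⟨m + n, ?_⟩
    rw [map_add]
    conv_lhs => enter [1]; rw [add_comm m n]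
    rw [pow_add, pow_add, Module.End.mul_apply, Module.End.mul_apply, hm, hn]
    simp
  | mul x y _ _ hx hy =>
    obtain ⟨m, hm⟩ := hx
    obtain ⟨n, hn⟩ := hy
    exact ⟨m + n, ad_pow_mul_eq_zero e _ m n rfl x y hm hn⟩

/-- In an algebra generated by an `sl₂`-triple, the only element of weight `2` which commutes
with `f` is zero. -/
theorem eq_zero_of_commute_f [CharZero K] (r : Sl2Relations h e f)
    (hg : Algebra.adjoin K {h, e, f} = ⊤) {y : B} (hy : h * y = y * h + 2 * y)
    (hf : f * y = y * f) : y = 0 := by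
  set D : Module.End K B := LinearMap.mulLeft K e - LinearMap.mulRight K e with hDdef
  have hD : ∀ y, D y = e * y - y * e := fun y => rfl
  have wt : ∀ n : ℕ, h * (D ^ n) y = (D ^ n) y * h + (2 * n + 2 : ℕ) * (D ^ n) y := by
    intro n
    induction n with
    | zero => simpa using hy
    | succ n ih =>
      rw [pow_succ', Module.End.mul_apply, hD]
      generalize (D ^ n) y = z at ih
      have c : e * ((2 * n + 2 : ℕ) * z) = (2 * n + 2 : ℕ) * (e * z) := by
        rw [← mul_assoc, ← Nat.cast_commute, mul_assoc]
      have h1 : h * (e * z) = e * z * h + (2 * n + 2 : ℕ) * (e * z) + 2 * (e * z) := by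
        rw [← mul_assoc, r.h_mul_e, add_mul, mul_assoc, ih, mul_add, c]
        noncomm_ring
      have h2 : h * (z * e) = z * e * h + 2 * (z * e) + (2 * n + 2 : ℕ) * (z * e) := by
        have c2 : z * (2 * e) = 2 * (z * e) := by noncomm_ring
        rw [← mul_assoc, ih, add_mul, mul_assoc z h e, r.h_mul_e, mul_add, c2]
        noncomm_ring
      rw [mul_sub, h1, h2]
      push_cast
      noncomm_ring
  -- Each application of `D = ad e` contributes the weight of the vector it hits, as `[f, e] = -h`;
  -- the constant is the sum of the weights `2k + 2` for `0 ≤ k ≤ n`.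
  have fD : ∀ n : ℕ, f * (D ^ (n + 1)) y =
      (D ^ (n + 1)) y * f - ((n + 1) * (n + 2) : ℕ) * (D ^ n) y := by
    have step : ∀ z : B, f * D z - D z * f = D (f * z - z * f) - (h * z - z * h) := by
      intro z
      have h1 : e * (f * z) = f * e * z + h * z := by rw [← mul_assoc, r.e_mul_f, add_mul]
      have h2 : z * e * f = z * f * e + z * h := by rw [mul_assoc, r.e_mul_f, mul_add, mul_assoc]
      rw [map_sub, hD, hD, hD, h1, sub_mul, h2]
      noncomm_ring
    intro n
    suffices hs : f * (D ^ (n + 1)) y - (D ^ (n + 1)) y * f =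
        -(((n + 1) * (n + 2) : ℕ) * (D ^ n) y) by
      rw [← add_sub_cancel ((D ^ (n + 1)) y * f) (f * _), hs, sub_eq_add_neg]
    induction n with
    | zero =>
      rw [zero_add, pow_one, pow_zero, Module.End.one_apply, step, hf, hy]
      simp
    | succ n ih =>
      rw [pow_succ', Module.End.mul_apply, step, ih, wt, map_neg, ← nsmul_eq_mul, map_nsmul,
        nsmul_eq_mul, ← Module.End.mul_apply, ← pow_succ']
      push_cast
      noncomm_ring
  obtain ⟨n, hn⟩ := r.exists_ad_e_pow_eq_zero hg y
  rw [← hDdef] at hn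
  -- Descent: if `D ^ (n + 1)` kills `y`, then `fD` and the nonzero constant force `D ^ n` to kill
  -- it too.
  induction n with
  | zero => simpa using hn
  | succ n ih =>
    apply ih
    have := fD n
    rw [hn, mul_zero, zero_mul, zero_sub, zero_eq_neg, ← nsmul_eq_mul,
      ← Nat.cast_smul_eq_nsmul K, smul_eq_zero] at this
    exact this.resolve_left (Nat.cast_ne_zero.mpr (by positivity))

end Algebra

end Sl2Relations

/-! ## Homomorphisms between constant deformations -/

section ConstantDeformation

variable {K : Type*} [Field K] {B B' : Type*} [Ring B] [Algebra K B] [Ring B'] [Algebra K B']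

/-- The extension of a `K`-algebra homomorphism `B → B'⟦X⟧` to a `K⟦X⟧`-algebra homomorphism
`B⟦X⟧ → B'⟦X⟧`. -/
def constantDeformationLift (f : B →ₐ[K] B'⟦X⟧) : B⟦X⟧ →ₐ[K⟦X⟧] B'⟦X⟧ where
  toFun a := PowerSeries.mk fun m =>
    ∑ p ∈ Finset.HasAntidiagonal.antidiagonal m, coeff p.2 (f (coeff p.1 a))
  map_zero' := by ext; simp
  map_add' a b := by ext; simp [Finset.sum_add_distrib]
  commutes' r := by
    ext m
    rw [coeff_mk, constantDeformation_algebraMap_apply, constantDeformation_algebraMap_apply,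
      coeff_map, Finset.sum_eq_single (m, 0)]
    · simp [coeff_map, PowerSeries.algebraMap_apply]
    · rintro ⟨i, j⟩ hij hne
      have : j ≠ 0 := by
        rintro rfl
        simp_all
      simp [coeff_map, PowerSeries.algebraMap_apply, coeff_C, this]
    · simp
  map_one' := by
    ext m
    rw [coeff_mk, Finset.sum_eq_single (0, m)]
    · simp
    · rintro ⟨i, j⟩ hij hne
      have : i ≠ 0 := by
        rintro rfl
        simp_all
      simp [coeff_one, this]
    · simp
  map_mul' a b := by
    ext m
    simp only [coeff_mk, coeff_mul, map_sum, map_mul, Finset.sum_mul_sum]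
    simp only [Finset.sum_sigma']
    -- Both sides sum over arrays with rows `(i, j)`, `(k, l)` and total `m`, grouped by rows or by
    -- columns. The bijection is transposition, its own inverse.
    refine Finset.sum_bij'
      (fun x _ => ⟨(x.2.1.1 + x.2.2.1, x.2.1.2 + x.2.2.2),
        ⟨(x.2.1.1, x.2.2.1), (x.2.1.2, x.2.2.2)⟩⟩)
      (fun x _ => ⟨(x.2.1.1 + x.2.2.1, x.2.1.2 + x.2.2.2),
        ⟨(x.2.1.1, x.2.2.1), (x.2.1.2, x.2.2.2)⟩⟩) ?_ ?_ ?_ ?_ ?_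
    all_goals
      rintro ⟨⟨p, q⟩, ⟨i, j⟩, ⟨k, l⟩⟩ hx
      simp only [Finset.mem_sigma, Finset.HasAntidiagonal.mem_antidiagonal] at hx
      obtain ⟨h1, h2, h3⟩ := hx
      subst h2 h3
      simp only [Finset.mem_sigma, Finset.HasAntidiagonal.mem_antidiagonal]
    all_goals first | rfl | exact ⟨by omega, trivial, trivial⟩

theorem coeff_constantDeformationLift (f : B →ₐ[K] B'⟦X⟧) (a : B⟦X⟧) (m : ℕ) :
    coeff m (constantDeformationLift f a) =
      ∑ p ∈ Finset.HasAntidiagonal.antidiagonal m, coeff p.2 (f (coeff p.1 a)) :=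
  coeff_mk m fun m =>
    ∑ p ∈ Finset.HasAntidiagonal.antidiagonal m, coeff p.2 (f (coeff p.1 a))

theorem constantDeformationLift_C (f : B →ₐ[K] B'⟦X⟧) (b : B) :
    constantDeformationLift f (C b) = f b := by
  ext m
  rw [coeff_constantDeformationLift, Finset.sum_eq_single (0, m)]
  · simp
  · rintro ⟨i, j⟩ hij hne
    have : i ≠ 0 := by
      rintro rfl
      simp_all
    simp [coeff_C, this]
  · simp

theorem constantCoeff_constantDeformationLift {f : B →ₐ[K] B⟦X⟧}
    (hf : ∀ b, constantCoeff (f b) = b) (a : B⟦X⟧) :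
    constantCoeff (constantDeformationLift f a) = constantCoeff a := by
  rw [← coeff_zero_eq_constantCoeff_apply, coeff_constantDeformationLift]
  simp [hf]

/-- A lift which is the identity modulo `X` is bijective. -/
theorem constantDeformationLift_bijective {f : B →ₐ[K] B⟦X⟧}
    (hf : ∀ b, constantCoeff (f b) = b) : Function.Bijective (constantDeformationLift f) := by
  -- The lift is unitriangular: its `m`-th coefficient is that of `a` plus terms in earlier
  -- coefficients. Hence the kernel vanishes by strong induction and preimages are solved for
  -- recursively.
  have hc : ∀ (a : B⟦X⟧) (m : ℕ), coeff m (constantDeformationLift f a) =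
      coeff m a + ∑ i : Fin m, coeff (m - i) (f (coeff i a)) := by
    intro a m
    rw [coeff_constantDeformationLift, Finset.Nat.sum_antidiagonal_eq_sum_range_succ
      (fun i j => coeff j (f (coeff i a))), Finset.sum_range_succ, add_comm, Nat.sub_self,
      coeff_zero_eq_constantCoeff_apply, hf, Finset.sum_range]
  constructor
  · refine (injective_iff_map_eq_zero _).mpr fun a ha => ?_
    ext m
    induction m using Nat.strong_induction_on with
    | _ m ih =>
      have := hc a m
      rw [ha, Finset.sum_eq_zero fun i _ => by rw [ih i i.2]; simp] at this
      simpa using this.symm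
  · intro b
    let a : ℕ → B := WellFounded.fix Nat.lt_wfRel.wf fun m a =>
      coeff m b - ∑ i : Fin m, coeff (m - i) (f (a i i.2))
    have ha : ∀ m, a m = coeff m b - ∑ i : Fin m, coeff (m - i) (f (a i)) := fun m =>
      WellFounded.fix_eq _ _ m
    refine ⟨PowerSeries.mk a, ?_⟩
    ext m
    rw [hc]
    simp only [coeff_mk]
    rw [ha m, sub_add_cancel]

theorem algebraMap_X_pow_mul (n : ℕ) (a : B⟦X⟧) :
    algebraMap K⟦X⟧ B⟦X⟧ (X ^ n) * a = a * X ^ n := by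
  rw [constantDeformation_algebraMap_apply, map_pow, map_X]
  exact (commute_X_pow a n).symm

/-- `K⟦X⟧`-algebra homomorphisms out of `B⟦X⟧` into constant deformations are determined by
their values on `B`. -/
theorem constantDeformation_algHom_ext {F G : B⟦X⟧ →ₐ[K⟦X⟧] B'⟦X⟧}
    (h : ∀ b : B, F (C b) = G (C b)) : F = G := by
  -- No continuity is assumed: linearity over `K⟦X⟧` lets `X` be pulled out, so splitting off the
  -- constant term gains one degree. The claim is for all `a` because the induction applies to the
  -- shifted series `c`.
  have key : ∀ n (a : B⟦X⟧), (∀ m < n, coeff m (F a) = coeff m (G a)) := by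
    intro n
    induction n with
    | zero => intro a m hm; omega
    | succ n ih =>
      intro a m hm
      obtain ⟨c, hc⟩ : ∃ c : B⟦X⟧, a = C (constantCoeff a) + c * X ^ 1 :=
        ⟨PowerSeries.mk fun p => coeff (p + 1) a, by
          rw [pow_one, add_comm]; exact eq_shift_mul_X_add_const a⟩
      rw [hc, ← algebraMap_X_pow_mul (K := K), map_add F, map_add G, map_mul F, map_mul G,
        AlgHom.commutes, AlgHom.commutes, h, algebraMap_X_pow_mul, algebraMap_X_pow_mul, map_add,
        map_add, pow_one]
      rcases m with _ | m
      · simp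
      · rw [coeff_succ_mul_X, coeff_succ_mul_X, ih c m (by omega)]
  ext a m
  exact key (m + 1) a m (by omega)

theorem mem_hIdeal_constantDeformation {a : B⟦X⟧} :
    a ∈ hIdeal K B⟦X⟧ ↔ constantCoeff a = 0 := by
  rw [hIdeal, Ideal.mem_span_singleton', constantDeformation_algebraMap_apply, map_X]
  constructor
  · rintro ⟨c, rfl⟩
    simp
  · intro h
    have := eq_shift_mul_X_add_const a
    rw [h, map_zero, add_zero] at this
    exact ⟨_, this.symm⟩

end ConstantDeformation

/-! ## The enveloping algebra of `sl₂` -/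

section EnvelopingAlgebra

attribute [local instance 100] LieRing.ofAssociativeRing

open UniversalEnvelopingAlgebra

/-- The universal property gives a map to the subalgebra `S`; followed by the inclusion it is the
identity on `L`, hence everywhere. -/
theorem UniversalEnvelopingAlgebra.adjoin_range_ι (R L : Type*) [CommRing R] [LieRing L]
    [LieAlgebra R L] :
    Algebra.adjoin R (Set.range (ι R : L → UniversalEnvelopingAlgebra R L)) = ⊤ := by
  set S := Algebra.adjoin R (Set.range (ι R : L → UniversalEnvelopingAlgebra R L)) with hS
  let j : L →ₗ⁅R⁆ S :=
    { toFun := fun x => ⟨ι R x, Algebra.subset_adjoin ⟨x, rfl⟩⟩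
      map_add' := fun x y => Subtype.ext (map_add _ x y)
      map_smul' := fun c x => Subtype.ext (map_smul _ c x)
      map_lie' := fun {x y} => Subtype.ext (LieHom.map_lie (ι R) x y) }
  have h : S.val.comp (lift R j) = AlgHom.id R _ := by
    ext x
    change S.val (lift R j (ι R x)) = ι R x
    rw [lift_ι_apply]
    rfl
  refine eq_top_iff.mpr fun a _ => ?_
  have : S.val (lift R j a) = a := DFunLike.congr_fun h a
  rw [← this]
  exact (lift R j a).2

variable (K : Type*) [Field K]

theorem Sl2.apply_one_one {K : Type*} [Field K] (x : Sl2 K) : x.1 1 1 = - x.1 0 0 := by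
  have : Matrix.trace x.1 = 0 := x.2
  rw [Matrix.trace_fin_two] at this
  linear_combination this

theorem Sl2.eq_sum_gen (x : Sl2 K) : x = (x.1 0 0) • Sl2.gen K .H + (x.1 1 0) • Sl2.gen K .Xm +
    (x.1 0 1) • Sl2.gen K .Xp := by
  ext i j
  fin_cases i <;> fin_cases j <;> simp [Sl2.gen, Sl2.apply_one_one]

theorem USl2.sl2Relations : Sl2Relations (ι K (Sl2.gen K .H) : USl2 K) (ι K (Sl2.gen K .Xp))
    (ι K (Sl2.gen K .Xm)) := by
  have h1 : ⁅Sl2.gen K .H, Sl2.gen K .Xp⁆ = (2 : K) • Sl2.gen K .Xp := by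
    ext i j
    fin_cases i <;> fin_cases j <;> (simp [Sl2.gen, Ring.lie_def]; try norm_num)
  have h2 : ⁅Sl2.gen K .H, Sl2.gen K .Xm⁆ = -((2 : K) • Sl2.gen K .Xm) := by
    ext i j
    fin_cases i <;> fin_cases j <;> (simp [Sl2.gen, Ring.lie_def]; try norm_num)
  have h3 : ⁅Sl2.gen K .Xp, Sl2.gen K .Xm⁆ = Sl2.gen K .H := by
    ext i j
    fin_cases i <;> fin_cases j <;> simp [Sl2.gen, Ring.lie_def]
  replace h1 := congrArg (ι K : Sl2 K → USl2 K) h1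
  replace h2 := congrArg (ι K : Sl2 K → USl2 K) h2
  replace h3 := congrArg (ι K : Sl2 K → USl2 K) h3
  rw [LieHom.map_lie, LieRing.of_associative_ring_bracket] at h1 h2 h3
  rw [map_smul, Algebra.smul_def, map_ofNat] at h1
  rw [map_neg, map_smul, Algebra.smul_def, map_ofNat] at h2
  exact ⟨by rw [← h1]; abel, by rw [sub_eq_add_neg, ← h2]; abel,
    by rw [← h3]; abel⟩

theorem USl2.adjoin_gen : Algebra.adjoin K {(ι K (Sl2.gen K .H) : USl2 K), ι K (Sl2.gen K .Xp),
    ι K (Sl2.gen K .Xm)} = ⊤ := by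
  rw [eq_top_iff, ← adjoin_range_ι, Algebra.adjoin_le_iff]
  rintro _ ⟨x, rfl⟩
  rw [Sl2.eq_sum_gen K x, map_add, map_add, map_smul, map_smul, map_smul]
  refine add_mem (add_mem ?_ ?_) ?_ <;>
    exact Subalgebra.smul_mem _ (Algebra.subset_adjoin (by simp)) _

variable {K} {B : Type*} [Ring B] [Algebra K B]

/-- The homomorphism from `U(sl₂)` given by elements satisfying the defining relations. -/
def USl2.lift {h e f : B} (r : Sl2Relations h e f) : USl2 K →ₐ[K] B :=
  UniversalEnvelopingAlgebra.lift K
    { toFun := fun x => (x.1 0 0) • h + (x.1 1 0) • f + (x.1 0 1) • e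
      map_add' := fun x y => by simp [add_smul]; abel
      map_smul' := fun c x => by simp [mul_smul]
      map_lie' := fun {x y} => by
        simp only [LieSubalgebra.coe_bracket, Ring.lie_def, Matrix.sub_apply, Matrix.mul_apply,
          Fin.sum_univ_two, Sl2.apply_one_one]
        generalize x.1 0 0 = a, x.1 1 0 = b, x.1 0 1 = c, y.1 0 0 = a', y.1 1 0 = b',
          y.1 0 1 = c'
        simp only [mul_add, add_mul, smul_mul_assoc, mul_smul_comm, r.h_mul_e, r.h_mul_f,
          r.e_mul_f]
        have h2 : ∀ z : B, 2 * z = (2 : K) • z := fun z => by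
          rw [Algebra.smul_def, map_ofNat]
        simp only [h2]
        module }

theorem USl2.lift_H {h e f : B} (r : Sl2Relations h e f) :
    USl2.lift (K := K) r (ι K (Sl2.gen K .H)) = h := by
  rw [USl2.lift, lift_ι_apply]
  simp [Sl2.gen]

theorem USl2.lift_Xp {h e f : B} (r : Sl2Relations h e f) :
    USl2.lift (K := K) r (ι K (Sl2.gen K .Xp)) = e := by
  rw [USl2.lift, lift_ι_apply]
  simp [Sl2.gen]

theorem USl2.lift_Xm {h e f : B} (r : Sl2Relations h e f) :
    USl2.lift (K := K) r (ι K (Sl2.gen K .Xm)) = f := by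
  rw [USl2.lift, lift_ι_apply]
  simp [Sl2.gen]

theorem USl2.algHom_ext {F G : USl2 K →ₐ[K] B}
    (h : ∀ x, F (ι K (Sl2.gen K x)) = G (ι K (Sl2.gen K x))) : F = G := by
  refine AlgHom.ext_of_adjoin_eq_top (USl2.adjoin_gen K) ?_
  rintro _ (rfl | rfl | rfl) <;> apply h

/-- Transported by `φ` and `g⁻¹`, this relation of `𝔞` gives `g⁻¹(X⁻)` weight `-2`. -/
theorem UALie.H_mul_Xm : UALie.gen K .H * UALie.gen K .Xm =
    UALie.gen K .Xm * UALie.gen K .H - 2 * UALie.gen K .Xm := by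
  have h1 : ⁅ALie.gen K .H, ALie.gen K .Xm⁆ + (2 : K) • ALie.gen K .Xm = 0 :=
    (LieSubmodule.Quotient.mk_eq_zero' (N := nonDeformedRelations K)).mpr
      (LieSubmodule.subset_lieSpan (Set.mem_insert_of_mem _ rfl))
  replace h1 := congrArg (ι K : ALie K → UALie K) h1
  rw [map_add, LieHom.map_lie, LieRing.of_associative_ring_bracket, map_smul, Algebra.smul_def,
    map_ofNat, map_zero] at h1
  replace h1 := congrArg (C : UALie K → (UALie K)⟦X⟧) h1
  simp only [map_add, map_sub, map_mul, map_ofNat, map_zero] at h1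
  rw [← sub_eq_zero, ← h1, UALie.gen, UALie.gen]
  abel

theorem USl2.structural_gen (x : ChevalleyGen) :
    USl2.structural K (ι K (ALie.gen K x)) = ι K (Sl2.gen K x) := by
  rw [USl2.structural, lift_ι_apply, LieHom.comp_apply, ALie.toSl2_gen]

end EnvelopingAlgebra

/-! ## Rigidity of trivializations -/

section Rigidity

theorem PowerSeries.C_mul_comm_of_coeff {B : Type*} [Ring B] {b : B} {w : B⟦X⟧}
    (h : ∀ n, b * coeff n w = coeff n w * b) : C b * w = w * C b := by
  ext n
  rw [coeff_C_mul, coeff_mul_C, h]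

theorem Sl2Relations.map {B B' : Type*} [Ring B] [Ring B'] {h e f : B} (r : Sl2Relations h e f)
    (g : B →+* B') : Sl2Relations (g h) (g e) (g f) where
  h_mul_e := by simpa only [map_mul, map_add, map_ofNat] using congrArg g r.h_mul_e
  h_mul_f := by simpa only [map_mul, map_sub, map_ofNat] using congrArg g r.h_mul_f
  e_mul_f := by simpa only [map_mul, map_add] using congrArg g r.e_mul_f

/-- Twisting an `sl₂`-triple by a unit of weight zero. -/
theorem Sl2Relations.twist {B : Type*} [Ring B] {h e f : B} (r : Sl2Relations h e f) {w w' : B}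
    (h₁ : w * w' = 1) (h₂ : w' * w = 1) (hw : h * w = w * h) (hc : f * e * w = w * (f * e)) :
    Sl2Relations h (w' * e) (f * w) := by
  have hw' : h * w' = w' * h := by
    rw [← one_mul (h * w'), ← h₂, mul_assoc w' w, ← mul_assoc w h, ← hw, mul_assoc h, h₁, mul_one]
  have h2 : w' * (2 * e) = 2 * (w' * e) := by noncomm_ring
  refine ⟨?_, ?_, ?_⟩
  · rw [← mul_assoc, hw', mul_assoc, r.h_mul_e, mul_add, h2, mul_assoc]
  · rw [← mul_assoc, r.h_mul_f, sub_mul, mul_assoc f h w, hw, mul_assoc, mul_assoc]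
  -- In `f w w⁻¹ e` the unit cancels, while `w⁻¹ e f w` is the conjugate of `f e + h`, with which
  -- `w` commutes.
  · rw [mul_assoc f, ← mul_assoc w, h₁, one_mul, mul_assoc, ← mul_assoc e, r.e_mul_f, add_mul,
      hc, hw, ← mul_add, ← mul_assoc, h₂, one_mul]

variable {K : Type*} [Field K] [CharZero K] {B : Type*} [Ring B] [Algebra K B] {h e f : B}

/-- The elements of weight `-2` in the constant deformation of an algebra generated by an
`sl₂`-triple which reduce to `f` are the products of `f` with units of weight zero. -/
theorem Sl2Relations.exists_eq_C_f_mul (r : Sl2Relations h e f)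
    (hg : Algebra.adjoin K {h, e, f} = ⊤) {Y : B⟦X⟧} (hY : C h * Y = Y * C h - 2 * Y)
    (hY₀ : constantCoeff Y = f) :
    ∃ w : B⟦X⟧, constantCoeff w = 1 ∧ Y = C f * w ∧ C h * w = w * C h ∧
      C (f * e) * w = w * C (f * e) := by
  -- Cancelling `f` is not available, so `u = 1` is imposed in degree zero to make the constant
  -- coefficient of `w` equal to `1`.
  have hn : ∀ n, ∃ u ∈ Algebra.adjoin K {h, f * e}, coeff n Y = f * u ∧ (n = 0 → u = 1) := by
    intro n
    rcases eq_or_ne n 0 with rfl | hn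
    · exact ⟨1, one_mem _, by simpa using hY₀, fun _ => rfl⟩
    · have := congrArg (coeff n) hY
      rw [map_sub, coeff_C_mul, coeff_mul_C, ← map_ofNat C 2, coeff_C_mul] at this
      obtain ⟨u, hu, hu'⟩ := r.exists_eq_f_mul hg this
      exact ⟨u, hu, hu', fun h => absurd h hn⟩
  choose u hu hYu hu1 using hn
  refine ⟨PowerSeries.mk u, ?_, ?_, C_mul_comm_of_coeff fun n => ?_,
    C_mul_comm_of_coeff fun n => ?_⟩
  · rw [← coeff_zero_eq_constantCoeff_apply, coeff_mk, hu1 0 rfl]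
  · ext n
    rw [coeff_C_mul, coeff_mk, hYu]
  · rw [coeff_mk, (r.weightZero_commute _ (hu n)).1]
  · rw [coeff_mk, (r.weightZero_commute _ (hu n)).2]

end Rigidity

/-! ### Reductions modulo `h`, and endomorphisms of `U(sl₂)⟦X⟧` fixing `H` -/

section Trivialization

attribute [local instance 100] LieRing.ofAssociativeRing

open UniversalEnvelopingAlgebra

variable {K : Type*} [Field K]

theorem ReducesToALieIso.sub_mem {A : Type*} [Ring A] [Algebra K⟦X⟧ A]
    {φ : (UALie K)⟦X⟧ →ₐ[K⟦X⟧] A} {g : (USl2 K)⟦X⟧ ≃ₐ[K⟦X⟧] A} (hg : ReducesToALieIso φ g)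
    (x : ChevalleyGen) : g (USl2.gen K x) - φ (UALie.gen K x) ∈ hIdeal K A := by
  have h1 := hg.2 (ι K (ALie.gen K x))
  have h2 : constantDeformationMap (USl2.structural K) (UALie.gen K x) = USl2.gen K x := by
    change PowerSeries.map _ (C _) = C _
    rw [map_C]
    exact congrArg C (USl2.structural_gen x)
  have h3 : HZero.mk K A (g (constantDeformationMap (USl2.structural K) (UALie.gen K x))) =
    HZero.mk K A (φ (UALie.gen K x)) := h1
  rw [h2] at h3
  exact Ideal.Quotient.eq.mp h3

theorem map_mem_hIdeal {A A' : Type*} [Ring A] [Algebra K⟦X⟧ A] [Ring A'] [Algebra K⟦X⟧ A']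
    (g : A →ₐ[K⟦X⟧] A') {a : A} (ha : a ∈ hIdeal K A) : g a ∈ hIdeal K A' := by
  obtain ⟨c, rfl⟩ := Ideal.mem_span_singleton'.mp ha
  exact Ideal.mem_span_singleton'.mpr ⟨g c, by simp⟩

/-- Composing with an endomorphism which is the identity modulo `h` does not change the
reduction modulo `h`. -/
theorem ReducesToALieIso.trans {A : Type*} [Ring A] [Algebra K⟦X⟧ A]
    {φ : (UALie K)⟦X⟧ →ₐ[K⟦X⟧] A} {g : (USl2 K)⟦X⟧ ≃ₐ[K⟦X⟧] A} (hg : ReducesToALieIso φ g)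
    (ψ : (USl2 K)⟦X⟧ ≃ₐ[K⟦X⟧] (USl2 K)⟦X⟧) (hψ : ∀ a, constantCoeff (ψ a) = constantCoeff a) :
    ReducesToALieIso φ (ψ.trans g) := by
  have : HZero.map (ψ.trans g : (USl2 K)⟦X⟧ →ₐ[K⟦X⟧] A) =
      HZero.map (g : (USl2 K)⟦X⟧ →ₐ[K⟦X⟧] A) := by
    refine AlgHom.ext fun x => ?_
    obtain ⟨a, rfl⟩ := Ideal.Quotient.mk_surjective (I := hIdeal K (USl2 K)⟦X⟧) x
    change HZero.mk K A (g (ψ a)) = HZero.mk K A (g a)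
    refine Ideal.Quotient.eq.mpr ?_
    rw [← map_sub]
    exact map_mem_hIdeal (g : (USl2 K)⟦X⟧ →ₐ[K⟦X⟧] A)
      (mem_hIdeal_constantDeformation.mpr (by rw [map_sub, hψ, sub_self]))
  rw [ReducesToALieIso, this]
  exact hg

variable [CharZero K]

/-- For `Y` of weight `-2` reducing to `X⁻`, there is an automorphism of `U(sl₂)⟦X⟧`, equal to
the identity modulo `h`, which fixes `H` and maps `X⁻` to `Y`. -/
theorem USl2.exists_algEquiv {Y : (USl2 K)⟦X⟧}
    (hY : USl2.gen K .H * Y = Y * USl2.gen K .H - 2 * Y)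
    (hY₀ : constantCoeff Y = ι K (Sl2.gen K .Xm)) :
    ∃ ψ : (USl2 K)⟦X⟧ ≃ₐ[K⟦X⟧] (USl2 K)⟦X⟧, ψ (USl2.gen K .H) = USl2.gen K .H ∧
      ψ (USl2.gen K .Xm) = Y ∧ ∀ a, constantCoeff (ψ a) = constantCoeff a := by
  have r := USl2.sl2Relations K
  obtain ⟨w, hw₀, rfl, hw, hwc⟩ := r.exists_eq_C_f_mul (USl2.adjoin_gen K) hY hY₀
  have h₁ := mul_invOfUnit w 1 (by simpa using hw₀)
  have h₂ := invOfUnit_mul w 1 (by simpa using hw₀)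
  have t := (r.map (C (R := USl2 K))).twist h₁ h₂ hw (by rw [← map_mul]; exact hwc)
  let F : USl2 K →ₐ[K] (USl2 K)⟦X⟧ := USl2.lift t
  have hF : ∀ b, constantCoeff (F b) = b := by
    let c : (USl2 K)⟦X⟧ →ₐ[K] USl2 K :=
      { (constantCoeff : (USl2 K)⟦X⟧ →+* USl2 K) with
        commutes' := fun x => by simp [PowerSeries.algebraMap_apply] }
    have : c.comp F = AlgHom.id K _ := by
      refine USl2.algHom_ext fun x => ?_
      change constantCoeff (F (ι K (Sl2.gen K x))) = ι K (Sl2.gen K x)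
      cases x
      · rw [USl2.lift_H, constantCoeff_C]
      · rw [USl2.lift_Xm, map_mul, constantCoeff_C, hw₀, mul_one]
      · rw [USl2.lift_Xp, map_mul, constantCoeff_C, constantCoeff_invOfUnit, inv_one, Units.val_one,
          one_mul]
    exact DFunLike.congr_fun this
  refine ⟨AlgEquiv.ofBijective _ (constantDeformationLift_bijective hF), ?_, ?_, ?_⟩
  · exact (constantDeformationLift_C F _).trans (USl2.lift_H t)
  · exact (constantDeformationLift_C F _).trans (USl2.lift_Xm t)
  · exact constantCoeff_constantDeformationLift hF

/-- An endomorphism of `U(sl₂)⟦X⟧` which fixes `H` and `X⁻` is the identity. -/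
theorem USl2.algHom_eq_id {θ : (USl2 K)⟦X⟧ →ₐ[K⟦X⟧] (USl2 K)⟦X⟧}
    (hH : θ (USl2.gen K .H) = USl2.gen K .H) (hXm : θ (USl2.gen K .Xm) = USl2.gen K .Xm) :
    θ = AlgHom.id K⟦X⟧ _ := by
  have r := USl2.sl2Relations K
  have rC := r.map (C (R := USl2 K))
  have rθ := rC.map (θ : (USl2 K)⟦X⟧ →+* (USl2 K)⟦X⟧)
  -- Both `X⁺` and `θ(X⁺)` complete `H`, `X⁻` to a triple, so every coefficient of their difference
  -- has weight `2` and commutes with `X⁻`.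
  have hXp : θ (USl2.gen K .Xp) = USl2.gen K .Xp := by
    rw [← sub_eq_zero]
    have e1 : USl2.gen K .H * θ (USl2.gen K .Xp) =
        θ (USl2.gen K .Xp) * USl2.gen K .H + 2 * θ (USl2.gen K .Xp) := by
      conv_lhs => rw [← hH]
      conv_rhs => rw [← hH]
      exact rθ.h_mul_e
    have e2 : USl2.gen K .H * USl2.gen K .Xp =
        USl2.gen K .Xp * USl2.gen K .H + 2 * USl2.gen K .Xp := rC.h_mul_e
    have e3 : θ (USl2.gen K .Xp) * USl2.gen K .Xm =
        USl2.gen K .Xm * θ (USl2.gen K .Xp) + USl2.gen K .H := by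
      conv_lhs => rw [← hXm]
      conv_rhs => rw [← hXm, ← hH]
      exact rθ.e_mul_f
    have e4 : USl2.gen K .Xp * USl2.gen K .Xm =
        USl2.gen K .Xm * USl2.gen K .Xp + USl2.gen K .H := rC.e_mul_f
    have w1 : USl2.gen K .H * (θ (USl2.gen K .Xp) - USl2.gen K .Xp) =
        (θ (USl2.gen K .Xp) - USl2.gen K .Xp) * USl2.gen K .H +
          2 * (θ (USl2.gen K .Xp) - USl2.gen K .Xp) := by
      rw [mul_sub, e1, e2]
      noncomm_ring
    have w2 : USl2.gen K .Xm * (θ (USl2.gen K .Xp) - USl2.gen K .Xp) =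
        (θ (USl2.gen K .Xp) - USl2.gen K .Xp) * USl2.gen K .Xm := by
      rw [sub_mul, e3, e4]
      noncomm_ring
    generalize θ (USl2.gen K .Xp) - USl2.gen K .Xp = d at w1 w2
    ext n
    have c1 := congrArg (coeff n) w1
    have c2 := congrArg (coeff n) w2
    rw [USl2.gen, map_add, coeff_C_mul, coeff_mul_C, ← map_ofNat C 2, coeff_C_mul] at c1
    rw [USl2.gen, coeff_C_mul, coeff_mul_C] at c2
    rw [map_zero]
    exact r.eq_zero_of_commute_f (USl2.adjoin_gen K) c1 c2
  let j : USl2 K →ₐ[K] (USl2 K)⟦X⟧ :=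
    { (C : USl2 K →+* (USl2 K)⟦X⟧) with
      commutes' := fun x => (PowerSeries.algebraMap_apply (A := USl2 K)).symm }
  let θj : USl2 K →ₐ[K] (USl2 K)⟦X⟧ :=
    { (θ : (USl2 K)⟦X⟧ →+* (USl2 K)⟦X⟧).comp (C : USl2 K →+* (USl2 K)⟦X⟧) with
      commutes' := fun x => by
        have := θ.commutes (C x)
        rw [constantDeformation_algebraMap_apply, map_C] at this
        rw [PowerSeries.algebraMap_apply]
        exact this }
  have hj : θj = j := by
    refine USl2.algHom_ext fun x => ?_
    change θ (USl2.gen K x) = USl2.gen K x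
    cases x
    exacts [hH, hXm, hXp]
  exact constantDeformation_algHom_ext fun b => DFunLike.congr_fun hj b

end Trivialization

end

theorem mainTheorem6 {K : Type*} [Field K] [CharZero K] {A : Type*} [Ring A] [Algebra K⟦X⟧ A]
    (φ : (UALie K)⟦X⟧ →ₐ[K⟦X⟧] A)
    (hA : IsFormalDeformation (USl2.structural K) φ)
    (hh : IsHTrivial φ) :
    IsBTrivial φ ∧ ∃! g : (USl2 K)⟦X⟧ ≃ₐ[K⟦X⟧] A, IsBTrivialization φ g := by
  have existence : IsBTrivial φ := by
    obtain ⟨g, hH, hg⟩ := hh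
    have hY : USl2.gen K .H * g.symm (φ (UALie.gen K .Xm)) =
        g.symm (φ (UALie.gen K .Xm)) * USl2.gen K .H - 2 * g.symm (φ (UALie.gen K .Xm)) := by
      apply g.injective
      have := congrArg φ (UALie.H_mul_Xm (K := K))
      simp only [map_mul, map_sub, map_ofNat] at this
      simpa only [map_mul, map_sub, map_ofNat, AlgEquiv.apply_symm_apply, hH] using this
    have hY₀ : constantCoeff (g.symm (φ (UALie.gen K .Xm))) =
        UniversalEnvelopingAlgebra.ι K (Sl2.gen K .Xm) := by
      have := map_mem_hIdeal (g.symm : A →ₐ[K⟦X⟧] (USl2 K)⟦X⟧) (hg.sub_mem .Xm)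
      rw [mem_hIdeal_constantDeformation] at this
      simp only [AlgEquiv.coe_toAlgHom, map_sub, AlgEquiv.symm_apply_apply] at this
      rw [sub_eq_zero, USl2.gen, constantCoeff_C] at this
      exact this.symm
    obtain ⟨ψ, hψH, hψX, hψ⟩ := USl2.exists_algEquiv hY hY₀
    -- `ψ.trans g` is `g ∘ ψ`, which sends `X⁻` to `g(Y) = φ(X⁻)`.
    exact ⟨ψ.trans g, by simp [hψH, hH], by simp [hψX], hg.trans ψ hψ⟩
  refine ⟨existence, ?_⟩
  obtain ⟨g, hg⟩ := existence
  refine ⟨g, hg, fun g' hg' => ?_⟩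
  -- `g⁻¹ ∘ g'` fixes `H` and `X⁻`, hence is the identity.
  have := USl2.algHom_eq_id (θ := (g'.trans g.symm : (USl2 K)⟦X⟧ →ₐ[K⟦X⟧] (USl2 K)⟦X⟧))
    (by simp [hg'.1, ← hg.1]) (by simp [hg'.2.1, ← hg.2.1])
  ext a
  have ha : g.symm (g' a) = a := DFunLike.congr_fun this a
  rw [← ha, AlgEquiv.apply_symm_apply, ha]
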